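/- Let $p$ be a prime, let $q=p^f\geqslant 11$, put $d=\gcd(2,q-1)$ and $G=\mathrm{PSL}_2(q)$, the projective special linear group of degree $2$ over the field with $q$ elements. Let $H$ be a maximal subgroup of $G$ that is isomorphic to the dihedral group $D_{2(q+1)/d}$ of order $2(q+1)/d$. For a subset $S$ of $G$, let $\mathrm{Aut}(G,S)$ denote the group of those automorphisms of $G$ that fix $S$ setwise. Then for any two involutions (elements of order $2$) $x,y\in G$ with $\langle x,y\rangle=H$, there are at least $$ \frac{q^2-4d^2fq-(d+2)q-4d^2f-3d^2+2d-1}{d} $$ involutions $z\in G$ such that $\langle x,y,z\rangle=G$ and $\mathrm{Aut}(G,\{x,y,z\})=1$. -/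

import Mathlib

open scoped Pointwise in
/-- `Aut(G, S)`: the group of automorphisms of the group `G` that fix the subset `S` setwise. -/
def autFixing (G : Type*) [Group G] (S : Set G) : Subgroup (MulAut G) :=
  MulAction.stabilizer (MulAut G) S

theorem mem_autFixing_iff {G : Type*} [Group G] {S : Set G} {φ : MulAut G} :
    φ ∈ autFixing G S ↔ φ '' S = S :=
  Iff.rfl

/-! Involutions are counted, and the bad ones subtracted. By maximality of `H`, an involution `z`
outside `H` generates `G` together with `x, y`. It is then bad only if a nontrivial automorphism
permutes `{x, y, z}`; since the three elements generate, the permutation is nontrivial, so it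
carries some pair to a different pair.

Automorphisms act on squared traces through a field endomorphism `σ` (`exists_tr_sq_map`). For lifts
`X, Y, Z` to `SL(2, F)`, a bad `z` therefore forces one of three relations between `tr (X * Y)`, `tr
(X * Z)`, `tr (Y * Z)`, up to sign and `σ` (`exists_tr_relation`). Involutions lift to traceless
matrices, and a traceless `Z` of determinant 1 is determined up to `d` choices by `(tr (X * Z), tr
(Y * Z))`: two linear conditions cut out a line, and the determinant gives a quadratic on it
(`exists_difference`). This needs `tr (X * Y) ^ 2 ≠ 4`, which holds because `H` is nonabelian
dihedral.

There are at most `f` choices of `σ`, so the relations leave at most `f * q`, `f * q` and `d * f *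
q` trace pairs. Hence the bad involutions number at most `|H| + 2 * d * f * q + d ^ 2 * f * q`,
against at least `q * (q - 1) / d` involutions in all. -/

namespace PSL2

/-! ### Matrix entries, traces and the projection -/

open Matrix
open scoped MatrixGroups

variable {F : Type*} [Field F]

/-- The projection `SL(2, F) → PSL(2, F)`. -/
def proj : SL(2, F) →* PSL(2, F) := QuotientGroup.mk' _

theorem proj_surjective : Function.Surjective (proj : SL(2, F) → PSL(2, F)) :=
  QuotientGroup.mk'_surjective _

theorem mul_entry (A B : SL(2, F)) (i j : Fin 2) :
    (A * B) i j = A i 0 * B 0 j + A i 1 * B 1 j := by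
  simp [Matrix.mul_apply, Fin.sum_univ_two]

theorem ext_entries {A B : SL(2, F)} :
    A = B ↔ A 0 0 = B 0 0 ∧ A 0 1 = B 0 1 ∧ A 1 0 = B 1 0 ∧ A 1 1 = B 1 1 := by
  rw [Matrix.SpecialLinearGroup.ext_iff]
  simp [Fin.forall_fin_two, and_assoc]

theorem det_entries (A : SL(2, F)) : A 0 0 * A 1 1 - A 0 1 * A 1 0 = 1 := by
  have := A.det_coe
  rwa [Matrix.det_fin_two] at this

/-- The element of `SL(2, F)` with given entries. -/
def mk (a b c d : F) (h : a * d - b * c = 1) : SL(2, F) :=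
  ⟨!![a, b; c, d], by rw [Matrix.det_fin_two_of, h]⟩

section entries
variable (a b c d : F) (h : a * d - b * c = 1)
@[simp] theorem mk_00 : mk a b c d h 0 0 = a := rfl
@[simp] theorem mk_01 : mk a b c d h 0 1 = b := rfl
@[simp] theorem mk_10 : mk a b c d h 1 0 = c := rfl
@[simp] theorem mk_11 : mk a b c d h 1 1 = d := rfl
variable (A : SL(2, F))
theorem inv_00 : A⁻¹ 0 0 = A 1 1 := by simp [Matrix.adjugate_fin_two]
theorem inv_01 : A⁻¹ 0 1 = -A 0 1 := by simp [Matrix.adjugate_fin_two]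
theorem inv_10 : A⁻¹ 1 0 = -A 1 0 := by simp [Matrix.adjugate_fin_two]
theorem inv_11 : A⁻¹ 1 1 = A 0 0 := by simp [Matrix.adjugate_fin_two]
theorem neg_entry (i j : Fin 2) : (-A) i j = -A i j := by simp
theorem one_00 : (1 : SL(2, F)) 0 0 = 1 := rfl
theorem one_01 : (1 : SL(2, F)) 0 1 = 0 := rfl
theorem one_10 : (1 : SL(2, F)) 1 0 = 0 := rfl
theorem one_11 : (1 : SL(2, F)) 1 1 = 1 := rfl
end entries

theorem proj_eq_iff {A B : SL(2, F)} : proj A = proj B ↔ B = A ∨ B = -A := by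
  change (QuotientGroup.mk A : PSL(2, F)) = QuotientGroup.mk B ↔ _
  rw [QuotientGroup.eq, Matrix.SpecialLinearGroup.mem_center_iff]
  have key : ∀ C : SL(2, F), (∃ r : F, r ^ Fintype.card (Fin 2) = 1 ∧ scalar (Fin 2) r = C.1) ↔
      C = 1 ∨ C = -1 := by
    intro C
    constructor
    · rintro ⟨r, hr, hC⟩
      have hC' : ∀ i j, C i j = scalar (Fin 2) r i j := fun i j => by rw [hC]
      have hent : C 0 0 = r ∧ C 0 1 = 0 ∧ C 1 0 = 0 ∧ C 1 1 = r := by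
        simp [hC']
      obtain ⟨h0, h1, h2, h3⟩ := hent
      rw [Fintype.card_fin, sq_eq_one_iff] at hr
      rcases hr with rfl | rfl
      · left; rw [ext_entries]; exact ⟨h0, h1, h2, h3⟩
      · right; rw [ext_entries]
        simp only [neg_entry, one_00, one_01, one_10, one_11, neg_zero]; exact ⟨h0, h1, h2, h3⟩
    · rintro (rfl | rfl)
      · exact ⟨1, by simp, by simp⟩
      · exact ⟨-1, by simp, by ext i j; fin_cases i <;> fin_cases j <;> simp⟩
  rw [key, inv_mul_eq_iff_eq_mul, inv_mul_eq_iff_eq_mul]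
  simp

theorem proj_neg (A : SL(2, F)) : proj (-A) = proj A := by
  rw [eq_comm, proj_eq_iff]; right; rfl

/-- The trace of an element of `SL(2, F)`. -/
def tr (A : SL(2, F)) : F := A 0 0 + A 1 1

theorem tr_neg (A : SL(2, F)) : tr (-A) = -tr A := by
  simp only [tr, neg_entry]; ring

theorem tr_mul_comm (A B : SL(2, F)) : tr (A * B) = tr (B * A) := by
  simp only [tr, mul_entry]; ring

theorem tr_conj (A B : SL(2, F)) : tr (A * B * A⁻¹) = tr B := by
  rw [tr_mul_comm, inv_mul_cancel_left]

/-! ### Unitriangular subgroups and their centralizers -/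

/-- Upper unitriangular matrices. -/
def up (a : F) : SL(2, F) := mk 1 a 0 1 (by ring)
/-- Lower unitriangular matrices. -/
def lo (a : F) : SL(2, F) := mk 1 0 a 1 (by ring)

theorem up_mul (a b : F) : up a * up b = up (a + b) := by
  simp [ext_entries, mul_entry, up, add_comm]
theorem lo_mul (a b : F) : lo a * lo b = lo (a + b) := by
  simp [ext_entries, mul_entry, lo, add_comm]
theorem up_inv (a : F) : (up a)⁻¹ = up (-a) := by
  simp only [ext_entries, inv_00, inv_01, inv_10, inv_11]; simp [up]
theorem proj_up_injective : Function.Injective fun a : F => proj (up a) := by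
  intro a b h
  rcases proj_eq_iff.1 h with h | h
  · exact (ext_entries.1 h).2.1.symm
  · obtain ⟨h1, h2, -⟩ := ext_entries.1 h
    rw [neg_entry] at h1 h2
    simp only [up, mk_00, mk_01] at h1 h2
    linear_combination a * h1 - h2
theorem proj_lo_injective : Function.Injective fun a : F => proj (lo a) := by
  intro a b h
  rcases proj_eq_iff.1 h with h | h
  · exact (ext_entries.1 h).2.2.1.symm
  · obtain ⟨h1, -, h2, -⟩ := ext_entries.1 h
    rw [neg_entry] at h1 h2
    simp only [lo, mk_00, mk_10] at h1 h2
    linear_combination a * h1 - h2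

/-- The centralizer of a nontrivial upper unitriangular element. -/
theorem exists_eq_up_of_commute {b : F} (hb : b ≠ 0) {g : PSL(2, F)}
    (h : Commute g (proj (up b))) : ∃ a, g = proj (up a) := by
  obtain ⟨A, rfl⟩ := proj_surjective g
  have h' : proj (A * up b) = proj (up b * A) := by simpa only [map_mul] using h.eq
  have hd := det_entries A
  have fin : A 1 0 = 0 → A 0 0 = A 1 1 → ∃ a, proj A = proj (up a) := by
    intro hc had
    rw [hc, ← had] at hd
    have : (A 0 0 - 1) * (A 0 0 + 1) = 0 := by linear_combination hd
    rcases mul_eq_zero.1 this with h1 | h1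
    · refine ⟨A 0 1, ?_⟩
      congr 1
      rw [ext_entries]
      refine ⟨?_, rfl, hc, ?_⟩ <;> simp only [up, mk_00, mk_11] <;> [skip; rw [← had]] <;>
        linear_combination h1
    · refine ⟨-A 0 1, ?_⟩
      rw [proj_eq_iff]
      right
      rw [ext_entries]
      simp only [neg_entry, up, mk_00, mk_01, mk_10, mk_11]
      refine ⟨by linear_combination h1, trivial, by rw [hc, neg_zero], ?_⟩
      rw [← had]; linear_combination h1
  rcases proj_eq_iff.1 h' with h' | h' <;> rw [ext_entries] at h' <;>
    simp only [neg_entry, mul_entry, up, mk_00, mk_01, mk_10, mk_11] at h' <;>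
    obtain ⟨h1, h2, h3, h4⟩ := h'
  · have hc : A 1 0 = 0 := by
      have : b * A 1 0 = 0 := by linear_combination h1
      simpa [hb] using this
    refine fin hc ?_
    have : b * (A 0 0 - A 1 1) = 0 := by linear_combination -h2
    simpa [hb, sub_eq_zero] using this
  · by_cases h2F : (2 : F) = 0
    · have hc : A 1 0 = 0 := by
        have : b * A 1 0 = 0 := by linear_combination h1 - A 0 0 * h2F
        simpa [hb] using this
      refine fin hc ?_
      have : b * (A 0 0 - A 1 1) = 0 := by
        linear_combination h2 - (A 0 1 + b * A 1 1) * h2F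
      simpa [hb, sub_eq_zero] using this
    · have hc : A 1 0 = 0 := by
        have : 2 * A 1 0 = 0 := by linear_combination h3
        simpa [h2F] using this
      have ha : A 0 0 = 0 := by
        have : 2 * A 0 0 = 0 := by linear_combination h1 - b * hc
        simpa [h2F] using this
      rw [hc, ha] at hd
      simp at hd

/-- The Weyl element conjugates the lower unitriangular group onto the upper one. -/
theorem exists_eq_lo_of_commute {b : F} (hb : b ≠ 0) {g : PSL(2, F)}
    (h : Commute g (proj (lo b))) : ∃ a, g = proj (lo a) := by
  let w : SL(2, F) := mk 0 1 (-1) 0 (by ring)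
  have hw : ∀ a : F, w * lo a * w⁻¹ = up (-a) := by
    intro a
    simp only [ext_entries, mul_entry, inv_00, inv_01, inv_10, inv_11]
    simp [w, up, lo]
  have h2 : Commute (proj w * g * (proj w)⁻¹) (proj (up (-b))) := by
    rw [← hw, map_mul, map_mul, map_inv]
    exact h.map (MulAut.conj (proj w)).toMonoidHom
  obtain ⟨a, ha⟩ := exists_eq_up_of_commute (neg_ne_zero.2 hb) h2
  refine ⟨-a, ?_⟩
  have := hw (-a)
  rw [neg_neg] at this
  rw [← this, map_mul, map_mul, map_inv] at ha
  simpa using ha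

/-! ### Hua's theorem -/

/-- Hua's theorem for a pair of additive maps interchanged by inversion. -/
theorem exists_ringHom_of_map_inv (α β : F → F) (hα : ∀ a b, α (a + b) = α a + α b)
    (hβ : ∀ a b, β (a + b) = β a + β b) (h : ∀ a, a ≠ 0 → α a * β a⁻¹ = 1) (h1 : α 1 = 1)
    (hsq : ringChar F = 2 → ∀ a : F, ∃ b, a = b ^ 2) :
    ∃ σ : F →+* F, (∀ a, α a = σ a) ∧ ∀ a, β a = σ a := by
  have hα0 : α 0 = 0 := by simpa using hα 0 0
  have hβ0 : β 0 = 0 := by simpa using hβ 0 0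
  have hαn : ∀ a, α (-a) = -α a := fun a => by
    have := hα a (-a); rw [add_neg_cancel, hα0] at this; linear_combination -this
  have hne : ∀ a, a ≠ 0 → α a ≠ 0 := fun a ha h0 => by simpa [h0] using h a ha
  have hαinv : ∀ a, a ≠ 0 → β a⁻¹ = (α a)⁻¹ := fun a ha => eq_inv_of_mul_eq_one_right (h a ha)
  have hβinv : ∀ a, a ≠ 0 → α a⁻¹ = (β a)⁻¹ := fun a ha => by
    have := h a⁻¹ (inv_ne_zero ha)
    rw [inv_inv] at this
    exact eq_inv_of_mul_eq_one_left this
  have hβne : ∀ a, a ≠ 0 → β a ≠ 0 := fun a ha h0 => by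
    have := hβinv a ha
    rw [h0, _root_.inv_zero] at this
    exact hne _ (inv_ne_zero ha) this
  have hsubα : ∀ a b, α (a - b) = α a - α b := fun a b => by
    rw [sub_eq_add_neg, hα, hαn, sub_eq_add_neg]
  have hua : ∀ a b, α (a * a * b) = α a * α a * β b := by
    intro a b
    by_cases ha : a = 0
    · simp [ha, hα0]
    by_cases hb : b = 0
    · simp [hb, hα0, hβ0]
    by_cases hab : a * b = 1
    · have hb' : b = a⁻¹ := eq_inv_of_mul_eq_one_right hab
      rw [mul_assoc, hab, mul_one, hb', mul_assoc, h a ha, mul_one]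
    have hc : b⁻¹ - a ≠ 0 := by
      intro h0
      apply hab
      rw [← sub_eq_zero.1 h0, inv_mul_cancel₀ hb]
    have h1ab : 1 - a * b ≠ 0 := fun h0 => hab (sub_eq_zero.1 h0).symm
    -- Hua's identity: `a - a * b * a` is built from `a` and `b` by addition and inversion alone, so
    -- `α` and `β` carry it over.
    have hs : a⁻¹ + (b⁻¹ - a)⁻¹ = (a * (1 - a * b))⁻¹ := by
      have : b⁻¹ - a = (1 - a * b) / b := by field_simp
      rw [this]; field_simp; ring
    have hne' : a * (1 - a * b) ≠ 0 := mul_ne_zero ha h1ab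
    have e1 : α (a * (1 - a * b)) = (β (a⁻¹ + (b⁻¹ - a)⁻¹))⁻¹ := by
      rw [hs, hαinv _ hne', inv_inv]
    rw [hβ, hαinv _ ha, hαinv _ hc, hsubα, hβinv _ hb] at e1
    have hA := hne a ha
    have hB := hβne b hb
    have hC : (β b)⁻¹ - α a ≠ 0 := by rw [← hβinv _ hb, ← hsubα]; exact hne _ hc
    have hAB : 1 - α a * β b ≠ 0 := by
      intro h0; apply hC; field_simp; linear_combination h0
    have e2 : ((α a)⁻¹ + ((β b)⁻¹ - α a)⁻¹)⁻¹ = α a * (1 - α a * β b) := by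
      have : (β b)⁻¹ - α a = (1 - α a * β b) / β b := by field_simp
      rw [this]
      have : (α a)⁻¹ + ((1 - α a * β b) / β b)⁻¹ = (α a * (1 - α a * β b))⁻¹ := by
        field_simp; ring
      rw [this, inv_inv]
    rw [e2, show a * (1 - a * b) = a - a * a * b by ring, hsubα] at e1
    linear_combination -e1
  have hαβ : ∀ b, α b = β b := fun b => by simpa [h1] using hua 1 b
  have hasq : ∀ a, α (a * a) = α a * α a := fun a => by
    have := hua a 1
    rwa [mul_one, ← hαβ, h1, mul_one] at this
  have hmul : ∀ a b, α (a * b) = α a * α b := by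
    intro a b
    -- In characteristic 2 every element is a square, so `hua` suffices; otherwise the rule for
    -- squares is polarized.
    by_cases h2 : (2 : F) = 0
    · have hchar : ringChar F = 2 := by
        have : ringChar F ∣ 2 := (ringChar.spec F 2).1 (by exact_mod_cast h2)
        rcases (Nat.dvd_prime Nat.prime_two).1 this with h' | h'
        · exact absurd h' CharP.ringChar_ne_one
        · exact h'
      obtain ⟨c, rfl⟩ := hsq hchar a
      rw [pow_two, hua, hasq, hαβ b]
    · have := hasq (a + b)
      rw [show (a + b) * (a + b) = a * a + b * b + (a * b + a * b) by ring, hα, hα, hα, hα, hasq,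
        hasq] at this
      have : 2 * (α (a * b) - α a * α b) = 0 := by linear_combination this
      simpa [h2, sub_eq_zero] using this
  refine ⟨{ toFun := α, map_one' := h1, map_mul' := hmul, map_zero' := hα0, map_add' := hα },
    fun _ => rfl, fun a => (hαβ a).symm⟩

/-! ### Unipotent elements -/

theorem eq_up_of_tr_eq_two {B : SL(2, F)} (hB : tr B = 2) (h10 : B 1 0 = 0) :
    B = up (B 0 1) := by
  have hd := det_entries B
  rw [tr] at hB
  have h00 : B 0 0 = 1 := by
    have : (B 0 0 - 1) ^ 2 = 0 := by linear_combination -hd + B 0 0 * hB - B 0 1 * h10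
    simpa [sub_eq_zero] using this
  rw [ext_entries]
  simp only [up, mk_00, mk_01, mk_10, mk_11]
  exact ⟨h00, trivial, h10, by linear_combination hB - h00⟩

/-- A nontrivial unipotent element of `SL(2, F)` is conjugate to an upper unitriangular one. -/
theorem exists_conj_up {B : SL(2, F)} (hB : tr B = 2) (hB1 : B ≠ 1) :
    ∃ P : SL(2, F), ∃ b, b ≠ 0 ∧ P * B * P⁻¹ = up b := by
  by_cases h10 : B 1 0 = 0
  · have := eq_up_of_tr_eq_two hB h10
    refine ⟨1, B 0 1, ?_, by simpa using this⟩
    intro h0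
    rw [h0] at this
    apply hB1
    rw [this, ext_entries]
    exact ⟨rfl, rfl, rfl, rfl⟩
  · have hd := det_entries B
    rw [tr] at hB
    refine ⟨mk 0 (B 1 0)⁻¹ (-B 1 0) (B 0 0 - 1) (by field_simp; ring), -(B 1 0)⁻¹,
      by simpa using h10, ?_⟩
    simp only [ext_entries, mul_entry, inv_00, inv_01, inv_10, inv_11, up, mk_00, mk_01, mk_10,
      mk_11]
    have h11 : B 1 1 = 2 - B 0 0 := by linear_combination hB
    rw [h11] at hd ⊢
    refine ⟨by field_simp; ring, by field_simp; ring, ?_, by field_simp; ring⟩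
    linear_combination (B 1 0) * hd

/-- A unipotent element of `SL(2, F)` that is not upper triangular is conjugate, by an upper
unitriangular element, to a lower unitriangular one. -/
theorem exists_up_conj_lo {B : SL(2, F)} (hB : tr B = 2) (h10 : B 1 0 ≠ 0) :
    ∃ a k : F, k ≠ 0 ∧ up a * B * (up a)⁻¹ = lo k := by
  have hd := det_entries B
  rw [tr] at hB
  have h11 : B 1 1 = 2 - B 0 0 := by linear_combination hB
  refine ⟨(1 - B 0 0) * (B 1 0)⁻¹, B 1 0, h10, ?_⟩
  simp only [ext_entries, mul_entry, inv_00, inv_01, inv_10, inv_11, up, lo, mk_00, mk_01, mk_10,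
      mk_11]
  rw [h11] at hd ⊢
  have h01 : B 0 1 = -(1 - B 0 0) ^ 2 * (B 1 0)⁻¹ := by field_simp; linear_combination -hd
  rw [h01]
  refine ⟨?_, ?_, ?_, ?_⟩ <;> field_simp <;> ring

/-- Elements of order `p` in characteristic `p` lift to unipotent elements. -/
theorem exists_unipotent_lift {p : ℕ} [Fact p.Prime] [CharP F p] {g : PSL(2, F)}
    (hg : g ^ p = 1) : ∃ B : SL(2, F), proj B = g ∧ tr B = 2 := by
  obtain ⟨A, rfl⟩ := proj_surjective g
  have hp1 : (-1 : F) ^ p = -1 := by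
    have := neg_one_pow_char F p
    exact this
  have hA : proj (A ^ p) = proj 1 := by rw [map_pow, hg, map_one]
  have key : ∀ A : SL(2, F), A ^ p = 1 → tr A = 2 := by
    intro A hA
    -- In characteristic `p`, `(A - 1) ^ p = A ^ p - 1 = 0`, and a nilpotent matrix has trace zero.
    have hN : IsNilpotent (A.1 - 1) := by
      refine ⟨p, ?_⟩
      rw [sub_pow_char_of_commute p (Commute.one_right _), one_pow,
        ← Matrix.SpecialLinearGroup.coe_pow, hA]
      simp
    have := (Matrix.isNilpotent_trace_of_isNilpotent hN).eq_zero
    rw [Matrix.trace_fin_two] at this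
    simp at this
    rw [tr]
    linear_combination this
  rcases proj_eq_iff.1 hA with h | h
  · exact ⟨A, rfl, key A h.symm⟩
  · refine ⟨-A, proj_neg A, key _ ?_⟩
    rcases (Fact.out : p.Prime).eq_two_or_odd' with rfl | hodd
    · have h2 : (2 : F) = 0 := by exact_mod_cast CharP.cast_eq_zero F 2
      have hneg : ∀ B : SL(2, F), -B = B := by
        intro B
        have : ∀ x : F, -x = x := fun x => by linear_combination -x * h2
        simp only [ext_entries, neg_entry, this, and_self]
      rw [hneg]; rw [hneg] at h; exact h.symm
    · rw [hodd.neg_pow, ← h]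

/-! ### Automorphisms and squared traces -/

theorem closure_up_lo (M : SL(2, F)) :
    M ∈ Subgroup.closure (Set.range (up : F → SL(2, F)) ∪ Set.range lo) := by
  refine SL2.transvection_induction _ ?_ (fun A B => mul_mem) M
  intro i j hij c
  apply Subgroup.subset_closure
  fin_cases i <;> fin_cases j
  · exact absurd rfl hij
  · left; refine ⟨c, ?_⟩
    rw [ext_entries]
    simp [up, SpecialLinearGroup.transvection_coe]
  · right; refine ⟨c, ?_⟩
    rw [ext_entries]
    simp [lo, SpecialLinearGroup.transvection_coe]
  · exact absurd rfl hij

/-- The endomorphism of `SL(2, F)` induced by a field endomorphism and conjugation by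
`diag(c, 1)`. -/
def semilinear (σ : F →+* F) (c : F) (hc : c ≠ 0) : SL(2, F) →* SL(2, F) where
  toFun M := mk (σ (M 0 0)) (c * σ (M 0 1)) (c⁻¹ * σ (M 1 0)) (σ (M 1 1)) (by
    have := congrArg σ (det_entries M)
    rw [map_sub, map_mul, map_mul, map_one] at this
    field_simp
    exact this)
  map_one' := by
    rw [ext_entries]
    simp [one_00, one_01, one_10, one_11]
  map_mul' A B := by
    rw [ext_entries]
    simp only [mul_entry, mk_00, mk_01, mk_10, mk_11, map_add, map_mul]
    refine ⟨?_, ?_, ?_, ?_⟩ <;> field_simp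

theorem tr_semilinear (σ : F →+* F) (c : F) (hc : c ≠ 0) (M : SL(2, F)) :
    tr (semilinear σ c hc M) = σ (tr M) := by
  simp [semilinear, tr]

theorem conj_up_entry (s t r : F) :
    (up s * lo t * up r * (up s * lo t)⁻¹) 0 1 = r * (1 + s * t) ^ 2 := by
  simp only [mul_entry, inv_01, inv_11, up, lo, mk_00, mk_01, mk_10, mk_11]
  ring

/-- This relation links the two unipotent subgroups: with `t = -s⁻¹`, the entry in `conj_up_entry`
vanishes. Applying an automorphism to it shows that inversion interchanges the two induced additive
maps. -/
theorem conj_up_eq_lo {s t : F} (h : 1 + s * t = 0) (r : F) :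
    up s * lo t * up r * (up s * lo t)⁻¹ = lo (-r * t ^ 2) := by
  simp only [ext_entries, mul_entry, inv_00, inv_01, inv_10, inv_11, up, lo, mk_00, mk_01, mk_10,
    mk_11]
  refine ⟨?_, ?_, ?_, ?_⟩
  · linear_combination (-r * t) * h
  · linear_combination r * (1 + s * t) * h
  · ring
  · linear_combination (r * t) * h

/-- An automorphism of `PSL(2, F)` that stabilizes the two opposite unipotent subgroups is
semilinear. -/
theorem exists_semilinear_of_stabilizes (ψ : MulAut PSL(2, F)) {b k : F} (hb : b ≠ 0) (hk : k ≠ 0)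
    (hup : ψ (proj (up 1)) = proj (up b)) (hlo : ψ (proj (lo 1)) = proj (lo k))
    (hsq : ringChar F = 2 → ∀ a : F, ∃ b, a = b ^ 2) :
    ∃ (σ : F →+* F) (c : F) (hc : c ≠ 0), ∀ M, ψ (proj M) = proj (semilinear σ c hc M) := by
  have hα : ∀ a, ∃ a', ψ (proj (up a)) = proj (up a') := fun a => by
    apply exists_eq_up_of_commute hb
    rw [← hup]
    refine Commute.map (?_ : Commute _ _) ψ
    rw [commute_iff_eq, ← map_mul, ← map_mul, up_mul, up_mul, add_comm]
  have hβ : ∀ a, ∃ a', ψ (proj (lo a)) = proj (lo a') := fun a => by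
    apply exists_eq_lo_of_commute hk
    rw [← hlo]
    refine Commute.map (?_ : Commute _ _) ψ
    rw [commute_iff_eq, ← map_mul, ← map_mul, lo_mul, lo_mul, add_comm]
  choose α hα using hα
  choose β hβ using hβ
  have hαadd : ∀ a b, α (a + b) = α a + α b := fun a b => by
    apply proj_up_injective
    simp only [← hα, ← up_mul, map_mul]
  have hβadd : ∀ a b, β (a + b) = β a + β b := fun a b => by
    apply proj_lo_injective
    simp only [← hβ, ← lo_mul, map_mul]
  have hα1 : α 1 = b := by
    apply proj_up_injective
    simp only [← hα, hup]
  have hαβ : ∀ a, a ≠ 0 → α a * β a⁻¹ = 1 := by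
    intro a ha
    have hrel := conj_up_eq_lo (s := a) (t := -a⁻¹) (by field_simp; ring) 1
    have h2 := congrArg (fun M => ψ (proj M)) hrel
    simp only [map_mul, map_inv, hα, hβ] at h2
    simp only [← map_mul, ← map_inv] at h2
    have h01 : (up (α a) * lo (β (-a⁻¹)) * up (α 1) * (up (α a) * lo (β (-a⁻¹)))⁻¹) 0 1 = 0 := by
      rcases proj_eq_iff.1 h2 with h | h
      · rw [← h]; rfl
      · have := congrArg (fun M : SL(2, F) => M 0 1) h
        simp only [neg_entry] at this
        rw [← neg_eq_zero, ← this]; rfl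
    rw [conj_up_entry, hα1] at h01
    have h01 : 1 + α a * β (-a⁻¹) = 0 := by simpa [hb] using h01
    have hneg : β (-a⁻¹) = - β a⁻¹ := by
      have h0 : β 0 = 0 := by simpa using hβadd 0 0
      have := hβadd a⁻¹ (-a⁻¹)
      rw [add_neg_cancel, h0] at this
      linear_combination -this
    rw [hneg] at h01
    linear_combination -h01
  obtain ⟨σ, hσα, hσβ⟩ := exists_ringHom_of_map_inv (fun a => b⁻¹ * α a) (fun a => b * β a)
    (fun a a' => by simp only [hαadd]; ring) (fun a a' => by simp only [hβadd]; ring)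
    (fun a ha => by
      have := hαβ a ha
      rw [mul_mul_mul_comm, inv_mul_cancel₀ hb, one_mul, this]) (by simp only [hα1]; field_simp) hsq
  refine ⟨σ, b, hb, fun M => ?_⟩
  have heq : Set.EqOn (ψ.toMonoidHom.comp proj) (proj.comp (semilinear σ b hb))
      (Set.range (up : F → SL(2, F)) ∪ Set.range lo) := by
    rintro _ (⟨a, rfl⟩ | ⟨a, rfl⟩)
    · change ψ (proj (up a)) = proj (semilinear σ b hb (up a))
      rw [hα]
      congr 1
      have := hσα a
      simp only [ext_entries, semilinear, up, MonoidHom.coe_mk, OneHom.coe_mk, mk_00, mk_01, mk_10,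
        mk_11, map_zero, map_one, ← this]
      refine ⟨trivial, by field_simp, by simp, trivial⟩
    · change ψ (proj (lo a)) = proj (semilinear σ b hb (lo a))
      rw [hβ]
      congr 1
      have := hσβ a
      simp only [ext_entries, semilinear, lo, MonoidHom.coe_mk, OneHom.coe_mk, mk_00, mk_01, mk_10,
        mk_11, map_zero, map_one, ← this]
      refine ⟨trivial, by simp, by field_simp, trivial⟩
  exact MonoidHom.eqOn_closure heq (closure_up_lo M)

theorem proj_up_pow_char (p : ℕ) [CharP F p] (a : F) : proj (up a) ^ p = 1 := by
  have : ∀ n : ℕ, up a ^ n = up (n * a) := by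
    intro n
    induction n with
    | zero => rw [pow_zero, ext_entries]; simp [up, one_00, one_01, one_10, one_11]
    | succ n ih => rw [pow_succ, ih, up_mul]; congr 1; push_cast; ring
  rw [← map_pow, this, CharP.cast_eq_zero, zero_mul, ← map_one proj]
  congr 1
  rw [ext_entries]; simp [up, one_00, one_01, one_10, one_11]

/-- Every automorphism of `PSL(2, F)`, `F` finite, acts on squares of traces through a field
endomorphism. -/
theorem exists_tr_sq_map [Finite F] (φ : MulAut PSL(2, F)) :
    ∃ σ : F →+* F, ∀ A B : SL(2, F), φ (proj A) = proj B → tr B ^ 2 = σ (tr A ^ 2) := by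
  obtain ⟨p, hp⟩ := CharP.exists F
  have : Fact p.Prime := ⟨CharP.char_is_prime F p⟩
  have hsq : ringChar F = 2 → ∀ a : F, ∃ b, a = b ^ 2 := by
    intro h2 a
    have : Fintype F := Fintype.ofFinite F
    obtain ⟨b, hb⟩ := FiniteField.isSquare_of_char_two h2 a
    exact ⟨b, by rw [hb, pow_two]⟩
  have hpow : ∀ a : F, proj (up a) ^ p = 1 := proj_up_pow_char p
  have hpow' : proj (lo (1 : F)) ^ p = 1 := by
    have : ∀ n : ℕ, lo (1 : F) ^ n = lo (n : F) := by
      intro n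
      induction n with
      | zero => rw [pow_zero, ext_entries]; simp [lo, one_00, one_01, one_10, one_11]
      | succ n ih => rw [pow_succ, ih, lo_mul]; congr 1; push_cast; ring
    rw [← map_pow, this, CharP.cast_eq_zero, ← map_one proj]
    congr 1
    rw [ext_entries]; simp [lo, one_00, one_01, one_10, one_11]
  have hup1 : proj (up (1 : F)) ≠ 1 := by
    intro h
    have h0 : proj (up (0 : F)) = 1 := by
      rw [← map_one proj]; congr 1
      rw [ext_entries]; exact ⟨rfl, rfl, rfl, rfl⟩
    exact one_ne_zero (proj_up_injective (h.trans h0.symm))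
  obtain ⟨B, hB, hBtr⟩ := exists_unipotent_lift (F := F) (p := p) (g := φ (proj (up 1)))
    (by rw [← map_pow, hpow, map_one])
  obtain ⟨P, b, hb, hP⟩ := exists_conj_up hBtr (by
    rintro rfl
    rw [map_one, eq_comm, EmbeddingLike.map_eq_one_iff] at hB
    exact hup1 hB)
  obtain ⟨C, hC, hCtr⟩ := exists_unipotent_lift (F := F) (p := p)
    (g := proj P * φ (proj (lo 1)) * (proj P)⁻¹)
    (by rw [conj_pow, ← map_pow, hpow', map_one, mul_one, mul_inv_cancel])
  -- Otherwise `C` and the image of `up 1` would be upper unitriangular in the same basis and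
  -- commute, whereas `lo 1` and `up 1` do not commute.
  have hC10 : C 1 0 ≠ 0 := by
    intro h10
    have hCup := eq_up_of_tr_eq_two hCtr h10
    have hcomm : Commute (proj C) (proj P * φ (proj (up 1)) * (proj P)⁻¹) := by
      rw [← hB, ← map_inv, ← map_mul, ← map_mul, hP, hCup, commute_iff_eq, ← map_mul, ← map_mul,
        up_mul, up_mul, add_comm]
    rw [hC] at hcomm
    have hcomm' : Commute (φ (proj (lo 1))) (φ (proj (up 1))) := by
      have := hcomm.map (MulAut.conj (proj P)⁻¹).toMonoidHom
      simpa [mul_assoc] using this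
    have hcomm'' : Commute (proj (lo (1 : F))) (proj (up 1)) := by
      have := hcomm'.map φ.symm.toMonoidHom
      simpa using this
    obtain ⟨a, ha⟩ := exists_eq_up_of_commute one_ne_zero hcomm''
    rcases proj_eq_iff.1 ha with h | h
    · have := (ext_entries.1 h).2.2.1
      simp [up, lo] at this
    · have := (ext_entries.1 h).2.2.1
      rw [neg_entry] at this
      simp [up, lo] at this
  obtain ⟨a, k, hk, hak⟩ := exists_up_conj_lo hCtr hC10
  let g : SL(2, F) := up a * P
  let ψ : MulAut PSL(2, F) := MulAut.conj (proj g) * φ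
  have hψ : ∀ x, ψ x = proj g * φ x * (proj g)⁻¹ := fun x => rfl
  have hψup : ψ (proj (up 1)) = proj (up b) := by
    rw [hψ, ← hB, ← map_inv, ← map_mul, ← map_mul]
    congr 1
    have : g * B * g⁻¹ = up a * (P * B * P⁻¹) * (up a)⁻¹ := by simp only [g]; group
    rw [this, hP, up_mul, up_inv, up_mul]
    congr 1; ring
  have hψlo : ψ (proj (lo 1)) = proj (lo k) := by
    rw [hψ, ← hak]
    simp only [g, map_mul, map_inv, hC]
    group
  obtain ⟨σ, c, hc, hσ⟩ := exists_semilinear_of_stabilizes ψ hb hk hψup hψlo hsq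
  refine ⟨σ, fun A B hAB => ?_⟩
  have h1 := hσ A
  rw [hψ, hAB, ← map_inv, ← map_mul, ← map_mul] at h1
  have h2 : tr (g * B * g⁻¹) ^ 2 = tr (semilinear σ c hc A) ^ 2 := by
    rcases proj_eq_iff.1 h1 with h | h
    · rw [h]
    · rw [h, tr_neg, neg_sq]
  rwa [tr_conj, tr_semilinear, ← map_pow] at h2

/-! ### Traceless matrices and their trace coordinates -/

theorem tr_mul_of_tr_eq_zero {A B : SL(2, F)} (hA : tr A = 0) (hB : tr B = 0) :
    tr (A * B) = 2 * A 0 0 * B 0 0 + A 0 1 * B 1 0 + A 1 0 * B 0 1 := by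
  rw [tr] at hA hB
  have hA : A 1 1 = -A 0 0 := by linear_combination hA
  have hB : B 1 1 = -B 0 0 := by linear_combination hB
  simp only [tr, mul_entry, hA, hB]; ring

theorem det_of_tr_eq_zero {A : SL(2, F)} (hA : tr A = 0) : A 0 0 ^ 2 + A 0 1 * A 1 0 = -1 := by
  have := det_entries A
  rw [tr] at hA
  linear_combination -this + A 0 0 * hA

theorem ext_of_tr_eq_zero {A B : SL(2, F)} (hA : tr A = 0) (hB : tr B = 0) (h0 : A 0 0 = B 0 0)
    (h1 : A 0 1 = B 0 1) (h2 : A 1 0 = B 1 0) : A = B := by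
  rw [tr] at hA hB
  rw [ext_entries]
  exact ⟨h0, h1, h2, by linear_combination hA - hB - h0⟩

theorem exists_eq_mul_of_cross {D0 D1 D2 n0 n1 n2 : F} (h01 : n1 * D0 = n0 * D1)
    (h02 : n2 * D0 = n0 * D2) (h12 : n2 * D1 = n1 * D2) (hn : n0 ^ 2 + n1 * n2 ≠ 0) :
    ∃ t, D0 = t * n0 ∧ D1 = t * n1 ∧ D2 = t * n2 := by
  by_cases h0 : n0 = 0
  · have h1 : n1 ≠ 0 := by rintro rfl; simp [h0] at hn
    refine ⟨D1 / n1, ?_, ?_, ?_⟩ <;> field_simp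
    · linear_combination h01
    · linear_combination -h12
  · refine ⟨D0 / n0, ?_, ?_, ?_⟩ <;> field_simp
    · linear_combination -h01
    · linear_combination -h02

/-- Two traceless `Z, Z'` in `SL(2, F)` whose products with `X` and `Y` have equal traces differ by
a multiple of the commutator `X * Y - Y * X`. -/
theorem exists_difference {X Y : SL(2, F)} (hX : tr X = 0) (hY : tr Y = 0)
    (hXY : tr (X * Y) ^ 2 ≠ 4) : ∃ n0 n1 n2 e : F, e ≠ 0 ∧ ((2 : F) = 0 → n1 = 0 ∧ n2 = 0) ∧
      ∀ Z Z' : SL(2, F), tr Z = 0 → tr Z' = 0 → tr (X * Z) = tr (X * Z') →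
        tr (Y * Z) = tr (Y * Z') → ∃ t : F, Z' 0 0 = Z 0 0 + t * n0 ∧ Z' 0 1 = Z 0 1 + t * n1 ∧
          Z' 1 0 = Z 1 0 + t * n2 ∧ t * (2 * Z 0 0 * n0 + Z 0 1 * n2 + Z 1 0 * n1 + t * e) = 0 := by
  have hXd := det_of_tr_eq_zero hX
  have hYd := det_of_tr_eq_zero hY
  rw [tr_mul_of_tr_eq_zero hX hY] at hXY
  -- The left side is minus the determinant of the commutator `X * Y - Y * X`, and equals `tr (X *
  -- Y) ^ 2 - 4`.
  have he : (X 0 1 * Y 1 0 - Y 0 1 * X 1 0) ^ 2 + (2 * (X 0 0 * Y 0 1 - Y 0 0 * X 0 1)) *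
      (2 * (X 1 0 * Y 0 0 - Y 1 0 * X 0 0)) ≠ 0 := by
    intro h
    apply hXY
    linear_combination h + 4 * (Y 0 0 ^ 2 + Y 0 1 * Y 1 0) * hXd - 4 * hYd
  refine ⟨X 0 1 * Y 1 0 - Y 0 1 * X 1 0, 2 * (X 0 0 * Y 0 1 - Y 0 0 * X 0 1),
    2 * (X 1 0 * Y 0 0 - Y 1 0 * X 0 0), _, he, fun h2 => ⟨by rw [h2, zero_mul], by rw [h2, zero_mul]⟩, ?_⟩
  intro Z Z' hZ hZ' h1 h2
  rw [tr_mul_of_tr_eq_zero hX hZ, tr_mul_of_tr_eq_zero hX hZ'] at h1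
  rw [tr_mul_of_tr_eq_zero hY hZ, tr_mul_of_tr_eq_zero hY hZ'] at h2
  obtain ⟨t, ht0, ht1, ht2⟩ := exists_eq_mul_of_cross (D0 := Z' 0 0 - Z 0 0)
    (D1 := Z' 0 1 - Z 0 1) (D2 := Z' 1 0 - Z 1 0)
    (by linear_combination X 0 1 * h2 - Y 0 1 * h1)
    (by linear_combination Y 1 0 * h1 - X 1 0 * h2)
    (by linear_combination 2 * X 0 0 * h2 - 2 * Y 0 0 * h1) he
  have e0 := sub_eq_iff_eq_add'.1 ht0
  have e1 := sub_eq_iff_eq_add'.1 ht1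
  have e2 := sub_eq_iff_eq_add'.1 ht2
  refine ⟨t, e0, e1, e2, ?_⟩
  have hZd := det_of_tr_eq_zero hZ
  have hZd' := det_of_tr_eq_zero hZ'
  rw [e0, e1, e2] at hZd'
  linear_combination hZd' - hZd

/-- Along the line through `Z₁` the parameter satisfies a quadratic with leading coefficient `e ≠ 0`
and root `t = 0`, so only one other root is possible. -/
theorem eq_or_eq_or_eq_of_tr {X Y : SL(2, F)} (hX : tr X = 0) (hY : tr Y = 0)
    (hXY : tr (X * Y) ^ 2 ≠ 4) {Z₁ Z₂ Z₃ : SL(2, F)} (h1 : tr Z₁ = 0) (h2 : tr Z₂ = 0)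
    (h3 : tr Z₃ = 0) (hX2 : tr (X * Z₁) = tr (X * Z₂)) (hY2 : tr (Y * Z₁) = tr (Y * Z₂))
    (hX3 : tr (X * Z₁) = tr (X * Z₃)) (hY3 : tr (Y * Z₁) = tr (Y * Z₃)) :
    Z₁ = Z₂ ∨ Z₁ = Z₃ ∨ Z₂ = Z₃ := by
  obtain ⟨n0, n1, n2, e, he, -, key⟩ := exists_difference hX hY hXY
  obtain ⟨t, ht0, ht1, ht2, ht⟩ := key Z₁ Z₂ h1 h2 hX2 hY2
  obtain ⟨s, hs0, hs1, hs2, hs⟩ := key Z₁ Z₃ h1 h3 hX3 hY3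
  rcases mul_eq_zero.1 ht with rfl | ht
  · left
    exact ext_of_tr_eq_zero h1 h2 (by simp [ht0]) (by simp [ht1]) (by simp [ht2])
  rcases mul_eq_zero.1 hs with rfl | hs
  · right; left
    exact ext_of_tr_eq_zero h1 h3 (by simp [hs0]) (by simp [hs1]) (by simp [hs2])
  have hst : s = t := by
    have : (s - t) * e = 0 := by linear_combination hs - ht
    simpa [he, sub_eq_zero] using this
  subst hst
  right; right
  exact ext_of_tr_eq_zero h2 h3 (by rw [ht0, hs0]) (by rw [ht1, hs1]) (by rw [ht2, hs2])

/-- In characteristic 2 the commutator is scalar and the linear term of the quadratic vanishes,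
leaving `t ^ 2 * e = 0`. -/
theorem eq_of_tr_of_char_two (h2F : (2 : F) = 0) {X Y : SL(2, F)} (hX : tr X = 0) (hY : tr Y = 0)
    (hXY : tr (X * Y) ^ 2 ≠ 4) {Z₁ Z₂ : SL(2, F)} (h1 : tr Z₁ = 0) (h2 : tr Z₂ = 0)
    (hX2 : tr (X * Z₁) = tr (X * Z₂)) (hY2 : tr (Y * Z₁) = tr (Y * Z₂)) : Z₁ = Z₂ := by
  obtain ⟨n0, n1, n2, e, he, hn, key⟩ := exists_difference hX hY hXY
  obtain ⟨t, ht0, ht1, ht2, ht⟩ := key Z₁ Z₂ h1 h2 hX2 hY2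
  obtain ⟨rfl, rfl⟩ := hn h2F
  have ht : t = 0 := by simpa [h2F, he] using ht
  subst ht
  exact ext_of_tr_eq_zero h1 h2 (by simp [ht0]) (by simp [ht1]) (by simp [ht2])

theorem ncard_le_of_fibers {α β : Type*} [Finite α] [Finite β] (S : Set α) (T : Set β) (g : α → β)
    (hg : ∀ a ∈ S, g a ∈ T) {d : ℕ} (hd : d = 1 ∨ d = 2)
    (h1 : d = 1 → ∀ a ∈ S, ∀ b ∈ S, g a = g b → a = b)
    (h2 : ∀ a ∈ S, ∀ b ∈ S, ∀ c ∈ S, g a = g b → g a = g c → a = b ∨ a = c ∨ b = c) :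
    S.ncard ≤ d * T.ncard := by
  classical
  rw [Set.ncard_eq_toFinset_card S, Set.ncard_eq_toFinset_card T]
  refine (Finset.card_le_mul_card_image (f := g) _ d ?_).trans
    (Nat.mul_le_mul_left _ (Finset.card_le_card ?_))
  · intro b _
    rcases hd with rfl | rfl
    · rw [Finset.card_le_one]
      intro x hx y hy
      simp only [Finset.mem_filter, Set.Finite.mem_toFinset] at hx hy
      exact h1 rfl x hx.1 y hy.1 (hx.2.trans hy.2.symm)
    · by_contra hlt
      obtain ⟨x, hx, y, hy, z, hz, hxy, hxz, hyz⟩ := Finset.two_lt_card.1 (not_le.1 hlt)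
      simp only [Finset.mem_filter, Set.Finite.mem_toFinset] at hx hy hz
      rcases h2 x hx.1 y hy.1 z hz.1 (hx.2.trans hy.2.symm) (hx.2.trans hz.2.symm) with h | h | h
      · exact hxy h
      · exact hxz h
      · exact hyz h
  · intro b hb
    obtain ⟨a, ha, rfl⟩ := Finset.mem_image.1 hb
    simp only [Set.Finite.mem_toFinset] at ha ⊢
    exact hg a ha

/-- Traceless elements of `SL(2, F)` counted by the traces of their products with two given
traceless elements. -/
theorem ncard_le_of_tr [Finite F] {d : ℕ} (hd : d = 1 ∧ (2 : F) = 0 ∨ d = 2) {X Y : SL(2, F)}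
    (hX : tr X = 0) (hY : tr Y = 0) (hXY : tr (X * Y) ^ 2 ≠ 4) (S : Set SL(2, F)) (T : Set (F × F))
    (hS : ∀ Z ∈ S, tr Z = 0 ∧ (tr (X * Z), tr (Y * Z)) ∈ T) : S.ncard ≤ d * T.ncard := by
  have : Finite SL(2, F) := Subtype.finite
  refine ncard_le_of_fibers S T (fun Z => (tr (X * Z), tr (Y * Z))) (fun Z hZ => (hS Z hZ).2)
    (hd.imp And.left id) ?_ ?_
  · rintro rfl Z hZ Z' hZ' h
    rw [Prod.mk.injEq] at h
    exact eq_of_tr_of_char_two (hd.resolve_right (by norm_num)).2 hX hY hXY (hS Z hZ).1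
      (hS Z' hZ').1 h.1 h.2
  · intro Z hZ Z' hZ' Z'' hZ'' h h'
    rw [Prod.mk.injEq] at h h'
    exact eq_or_eq_or_eq_of_tr hX hY hXY (hS Z hZ).1 (hS Z' hZ').1 (hS Z'' hZ'').1 h.1 h.2 h'.1 h'.2

/-! ### Involutions -/

/-- An involution satisfies `X⁻¹ = ± X`. The sign `-` gives trace zero; the sign `+` forces `X = ±
1` unless the characteristic is 2, where the signs agree. -/
theorem tr_eq_zero_of_orderOf {X : SL(2, F)} (h : orderOf (proj X) = 2) : tr X = 0 := by
  have h1 : proj X ≠ 1 := by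
    intro h1; rw [h1, orderOf_one] at h; norm_num at h
  have h2 : proj X = proj X⁻¹ := by
    have h2 := pow_orderOf_eq_one (proj X)
    rwa [h, pow_two, ← eq_inv_iff_mul_eq_one, ← map_inv] at h2
  rcases proj_eq_iff.1 h2 with h | h <;> rw [ext_entries] at h <;>
    simp only [inv_00, inv_01, inv_10, inv_11, neg_entry] at h <;> obtain ⟨e0, e1, e2, e3⟩ := h
  · by_cases h2F : (2 : F) = 0
    · rw [tr]; linear_combination e0 + X 0 0 * h2F
    · exfalso
      have hb : X 0 1 = 0 := by
        have : 2 * X 0 1 = 0 := by linear_combination -e1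
        simpa [h2F] using this
      have hc : X 1 0 = 0 := by
        have : 2 * X 1 0 = 0 := by linear_combination -e2
        simpa [h2F] using this
      have hd := det_entries X
      rw [e0, hb] at hd
      have : (X 0 0 - 1) * (X 0 0 + 1) = 0 := by linear_combination hd
      apply h1
      rw [← map_one proj, eq_comm, proj_eq_iff]
      refine (mul_eq_zero.1 this).imp (fun h => ?_) (fun h => ?_) <;> rw [ext_entries] <;>
        simp only [neg_entry, one_00, one_01, one_10, one_11] <;>
        refine ⟨by linear_combination h, ?_, ?_, by linear_combination e0 + h⟩ <;> simp [hb, hc]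
  · rw [tr]; linear_combination e0

theorem orderOf_proj_eq_two {X : SL(2, F)} (h : tr X = 0) (h10 : X 1 0 ≠ 0) :
    orderOf (proj X) = 2 := by
  apply orderOf_eq_prime
  · have : X * X = -1 := by
      have hd := det_of_tr_eq_zero h
      rw [tr] at h
      rw [ext_entries]
      simp only [mul_entry, neg_entry, one_00, one_01, one_10, one_11]
      refine ⟨by linear_combination hd, by linear_combination X 0 1 * h,
        by linear_combination X 1 0 * h, by linear_combination hd + (X 1 1 - X 0 0) * h⟩
    rw [pow_two, ← map_mul, this, proj_neg, map_one]
  · intro h1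
    rw [← map_one proj, eq_comm, proj_eq_iff] at h1
    rcases h1 with rfl | rfl
    · exact h10 rfl
    · exact h10 (by rw [neg_entry, one_10, neg_zero])

/-- A lower bound for the number of involutions of `PSL(2, F)`. -/
theorem le_ncard_involutions [Finite F] {d : ℕ} (hd : d = 1 ∧ (2 : F) = 0 ∨ d = 2) :
    Nat.card F * (Nat.card F - 1) ≤ d * {z : PSL(2, F) | orderOf z = 2}.ncard := by
  have : Finite SL(2, F) := Subtype.finite
  have : Finite PSL(2, F) := Finite.of_surjective _ proj_surjective
  -- Traceless matrices with nonzero lower left entry; the determinant fixes the upper right one.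
  -- Those with lower left entry zero are not needed for a lower bound.
  let m : F × Fˣ → SL(2, F) := fun v =>
    mk v.1 (-(1 + v.1 ^ 2) / v.2) v.2 (-v.1) (by field_simp; ring)
  have hm : Function.Injective m := by
    rintro ⟨a, u⟩ ⟨b, v⟩ h
    obtain ⟨h0, -, h2, -⟩ := ext_entries.1 h
    simp only [m, mk_00, mk_10] at h0 h2
    exact Prod.ext h0 (Units.ext h2)
  have hcard : (Set.univ : Set (F × Fˣ)).ncard = Nat.card F * (Nat.card F - 1) := by
    rw [Set.ncard_univ, Nat.card_prod, Nat.card_units]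
  rw [← hcard]
  refine ncard_le_of_fibers _ _ (fun v => proj (m v)) ?_ (hd.imp And.left id) ?_ ?_
  · rintro ⟨a, u⟩ -
    exact orderOf_proj_eq_two (by simp [m, tr]) (by simp [m])
  · rintro rfl v - w - h
    apply hm
    have h2F := (hd.resolve_right (by norm_num)).2
    have hneg : ∀ x : F, -x = x := fun x => by linear_combination -x * h2F
    rcases proj_eq_iff.1 h with h | h
    · exact h.symm
    · rw [h, ext_entries]; simp only [neg_entry, hneg, and_self]
  · intro u _ v _ w _ huv huw
    rcases proj_eq_iff.1 huv with h | h
    · left; exact hm h.symm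
    rcases proj_eq_iff.1 huw with h' | h'
    · right; left; exact hm h'.symm
    · right; right; exact hm (h.trans h'.symm)

/-! ### Field endomorphisms and the dihedral condition -/

/-- Every endomorphism fixes the prime field, so it is an algebra homomorphism over it, and these
number at most the degree. -/
theorem natCard_ringHom_le {p f : ℕ} (hp : p.Prime) (hF : Nat.card F = p ^ f) :
    Finite (F →+* F) ∧ Nat.card (F →+* F) ≤ f ∧ CharP F p := by
  have hfin : Finite F := Nat.finite_of_card_ne_zero (by rw [hF]; exact pow_ne_zero _ hp.ne_zero)
  obtain ⟨r, hr⟩ := CharP.exists F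
  have : Fact r.Prime := ⟨CharP.char_is_prime F r⟩
  let _ : Algebra (ZMod r) F := ZMod.algebra F r
  have hcard := Module.natCard_eq_pow_finrank (K := ZMod r) (V := F)
  rw [hF, Nat.card_zmod] at hcard
  have hf : f ≠ 0 := by
    rintro rfl
    have := Finite.one_lt_card (α := F)
    rw [hF, pow_zero] at this
    exact lt_irrefl _ this
  obtain rfl : p = r := Nat.prime_eq_prime_of_dvd_pow hp Fact.out (hcard ▸ dvd_pow_self p hf)
  have hff : f = Module.finrank (ZMod p) F := Nat.pow_right_injective hp.two_le hcard
  have hfinAlg : Finite (F →ₐ[ZMod p] F) := inferInstance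
  let g : (F →+* F) → (F →ₐ[ZMod p] F) := fun σ =>
    { σ with
      commutes' := fun c =>
        RingHom.congr_fun (RingHom.ext_zmod (σ.comp (algebraMap _ F)) (algebraMap _ F)) c }
  have hg : Function.Injective g := fun σ τ h => by
    ext x
    exact DFunLike.congr_fun h x
  refine ⟨Finite.of_injective g hg, ?_, hr⟩
  rw [hff]
  exact (Nat.card_le_card_of_injective g hg).trans (card_algHom_le_finrank (ZMod p) F F)

theorem proj_pow_char {p : ℕ} [CharP F p] {A : SL(2, F)} (hA : tr A ^ 2 = 4) :
    proj A ^ p = 1 := by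
  have key : ∀ A : SL(2, F), tr A = 2 → proj A ^ p = 1 := by
    intro A hA
    by_cases h1 : A = 1
    · rw [h1, map_one, one_pow]
    obtain ⟨P, b, -, hP⟩ := exists_conj_up hA h1
    have := proj_up_pow_char p b
    rwa [← hP, map_mul, map_mul, map_inv, conj_pow, mul_inv_eq_one, mul_eq_left] at this
  have : (tr A - 2) * (tr A + 2) = 0 := by linear_combination hA
  rcases mul_eq_zero.1 this with h | h
  · exact key A (sub_eq_zero.1 h)
  · rw [← proj_neg]
    exact key _ (by rw [tr_neg]; linear_combination -h)

/-- Two commuting elements do not generate a nonabelian dihedral group. -/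
theorem mul_ne_mul_of_dihedral {G : Type*} [Group G] {x y : G} {n : ℕ} (hn : 3 ≤ n)
    (e : Subgroup.closure {x, y} ≃* DihedralGroup n) : x * y ≠ y * x := by
  intro h
  have hc : IsMulCommutative (Subgroup.closure {x, y}) := by
    apply Subgroup.isMulCommutative_closure
    rintro a (rfl | rfl) b (rfl | rfl)
    · rfl
    · exact h
    · exact h.symm
    · rfl
  refine DihedralGroup.not_commutative (n := n) (by omega) (by omega) ⟨⟨fun a b => ?_⟩⟩
  have := hc.is_comm.comm (e.symm a) (e.symm b)
  apply e.symm.injective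
  rw [map_mul, map_mul, this]

/-- If equality held, the order of `xy` would divide `p`. For `p = 2` this gives `(xy) ^ 2 = 1`;
otherwise the order also divides `|H| = p ^ f + 1`, so `xy = 1`. Either way `x` and `y` commute. -/
theorem tr_mul_sq_ne_four {p f n : ℕ} (hp : p.Prime) (hf : f ≠ 0) [CharP F p] (hd : p = 2 ∨ 2 * n = p ^ f + 1) (hn : 3 ≤ n)
    {X Y : SL(2, F)} (hX : orderOf (proj X) = 2) (hY : orderOf (proj Y) = 2)
    (e : Subgroup.closure {proj X, proj Y} ≃* DihedralGroup n) : tr (X * Y) ^ 2 ≠ 4 := by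
  intro h4
  apply mul_ne_mul_of_dihedral hn e
  have hpow := proj_pow_char (p := p) h4
  rw [map_mul] at hpow
  have hx := pow_orderOf_eq_one (proj X)
  have hy := pow_orderOf_eq_one (proj Y)
  rw [hX, pow_two] at hx
  rw [hY, pow_two] at hy
  have hcomm : (proj X * proj Y) ^ 2 = 1 → proj X * proj Y = proj Y * proj X := by
    intro h
    rw [pow_two] at h
    rw [eq_inv_of_mul_eq_one_left h, _root_.mul_inv_rev, inv_eq_of_mul_eq_one_left hx,
      inv_eq_of_mul_eq_one_left hy]
  apply hcomm
  rcases hd with rfl | hd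
  · exact hpow
  · have h1 : orderOf (proj X * proj Y) ∣ p := orderOf_dvd_of_pow_eq_one hpow
    have h2 : orderOf (proj X * proj Y) ∣ p ^ f + 1 := by
      rw [← hd, ← DihedralGroup.nat_card, ← Nat.card_congr e.toEquiv]
      exact Subgroup.orderOf_dvd_natCard _ (mul_mem (Subgroup.subset_closure (by simp))
        (Subgroup.subset_closure (by simp)))
    have h3 : orderOf (proj X * proj Y) ∣ 1 :=
      (Nat.dvd_add_right (h1.trans (dvd_pow_self p hf))).1 h2
    rw [orderOf_eq_one_iff.1 (Nat.dvd_one.1 h3), one_pow]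

/-! ### Counting the bad involutions -/

/-- If `x, y, z` generate and are pairwise distinct, a nontrivial automorphism permuting them
satisfies one of three relations on squared traces. -/
theorem exists_tr_relation [Finite F] {X Y Z : SL(2, F)} (hxy : proj X ≠ proj Y)
    (hxz : proj X ≠ proj Z) (hyz : proj Y ≠ proj Z)
    (htop : Subgroup.closure {proj X, proj Y, proj Z} = ⊤)
    (hne : autFixing PSL(2, F) {proj X, proj Y, proj Z} ≠ ⊥) :
    ∃ σ : F →+* F, tr (X * Z) ^ 2 = σ (tr (X * Y)) ^ 2 ∨ tr (Y * Z) ^ 2 = σ (tr (X * Y)) ^ 2 ∨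
      tr (Y * Z) ^ 2 = σ (tr (X * Z)) ^ 2 := by
  obtain ⟨φ, hφ, hφ1⟩ := (Subgroup.bot_or_exists_ne_one _).resolve_left hne
  rw [mem_autFixing_iff] at hφ
  have hmem : ∀ a ∈ ({proj X, proj Y, proj Z} : Set PSL(2, F)),
      φ a = proj X ∨ φ a = proj Y ∨ φ a = proj Z := by
    intro a ha
    have : φ a ∈ φ '' {proj X, proj Y, proj Z} := Set.mem_image_of_mem _ ha
    rw [hφ] at this
    simpa using this
  obtain ⟨σ, hσ⟩ := exists_tr_sq_map φ
  have rel : ∀ A B C D : SL(2, F), φ (proj A) = proj C → φ (proj B) = proj D →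
      tr (C * D) ^ 2 = σ (tr (A * B)) ^ 2 := by
    intro A B C D h1 h2
    rw [← map_pow]
    apply hσ
    rw [map_mul, map_mul, map_mul, h1, h2]
  have hinj : ∀ {a b c}, φ a = c → φ b = c → a = b := fun h h' => φ.injective (h.trans h'.symm)
  refine ⟨σ, ?_⟩
  -- If `z` moves, the pair `x, y` goes to a pair containing `z`; if `z` is fixed, `x` and `y` must
  -- be swapped.
  rcases hmem (proj Z) (by simp) with hz | hz | hz
  · right; left
    rcases hmem (proj X) (by simp) with hx | hx | hx
    · exact absurd (hinj hx hz) hxz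
    · rcases hmem (proj Y) (by simp) with hy | hy | hy
      · exact absurd (hinj hy hz) hyz
      · exact absurd (hinj hx hy) hxy
      · exact rel _ _ _ _ hx hy
    · rcases hmem (proj Y) (by simp) with hy | hy | hy
      · exact absurd (hinj hy hz) hyz
      · rw [tr_mul_comm]; exact rel _ _ _ _ hx hy
      · exact absurd (hinj hx hy) hxy
  · left
    rcases hmem (proj X) (by simp) with hx | hx | hx
    · rcases hmem (proj Y) (by simp) with hy | hy | hy
      · exact absurd (hinj hx hy) hxy
      · exact absurd (hinj hy hz) hyz
      · exact rel _ _ _ _ hx hy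
    · exact absurd (hinj hx hz) hxz
    · rcases hmem (proj Y) (by simp) with hy | hy | hy
      · rw [tr_mul_comm]; exact rel _ _ _ _ hx hy
      · exact absurd (hinj hy hz) hyz
      · exact absurd (hinj hx hy) hxy
  · right; right
    rcases hmem (proj X) (by simp) with hx | hx | hx
    · exfalso
      rcases hmem (proj Y) (by simp) with hy | hy | hy
      · exact hxy (hinj hx hy)
      · apply hφ1
        have heq : Set.EqOn φ.toMonoidHom (MonoidHom.id _)
            ({proj X, proj Y, proj Z} : Set PSL(2, F)) := by
          rintro _ (rfl | rfl | rfl)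
          · exact hx
          · exact hy
          · exact hz
        ext a
        exact MonoidHom.eqOn_closure heq (htop ▸ Subgroup.mem_top a)
      · exact hyz (hinj hy hz)
    · exact rel _ _ _ _ hx hz
    · exact absurd (hinj hx hz) hxz

theorem ncard_range_le {α β : Type*} [Finite α] (g : α → β) :
    (Set.range g).ncard ≤ Nat.card α := by
  rw [← Set.image_univ, ← Set.ncard_univ]
  exact Set.ncard_image_le

/-- An upper bound for the number of involutions of `PSL(2, F)` in terms of those that generate the
group together with `x, y` and for which `Aut(G, {x, y, z})` is trivial. -/
theorem ncard_involutions_le [Finite F] {f d : ℕ} (hσ : Finite (F →+* F))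
    (hf : Nat.card (F →+* F) ≤ f) (hd : d = 1 ∧ (2 : F) = 0 ∨ d = 2) {X Y : SL(2, F)}
    (hX : tr X = 0) (hY : tr Y = 0) (hXY : tr (X * Y) ^ 2 ≠ 4)
    {H : Subgroup PSL(2, F)} (hH : IsCoatom H) (hgen : Subgroup.closure {proj X, proj Y} = H) :
    {z : PSL(2, F) | orderOf z = 2}.ncard ≤
      {z : PSL(2, F) | orderOf z = 2 ∧ Subgroup.closure {proj X, proj Y, z} = ⊤ ∧
        autFixing PSL(2, F) {proj X, proj Y, z} = ⊥}.ncard + Nat.card H +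
        (2 * (d * (f * Nat.card F)) + d * (d * (f * Nat.card F))) := by
  have : Finite SL(2, F) := Subtype.finite
  have : Finite PSL(2, F) := Finite.of_surjective _ proj_surjective
  have hrange : ∀ g : (F →+* F) × F → F × F, (Set.range g).ncard ≤ f * Nat.card F := by
    intro g
    refine (ncard_range_le g).trans ?_
    rw [Nat.card_prod]
    exact Nat.mul_le_mul_right _ hf
  let S₁ : Set SL(2, F) := {Z | tr Z = 0 ∧ ∃ σ : F →+* F, tr (X * Z) = σ (tr (X * Y))}
  let S₂ : Set SL(2, F) := {Z | tr Z = 0 ∧ ∃ σ : F →+* F, tr (Y * Z) = σ (tr (X * Y))}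
  -- Replacing `Z` by `-Z` absorbs the sign in `S₁` and `S₂`, but here it changes both traces, so
  -- both signs stay; this is the extra factor `d`.
  let S₃ : Set SL(2, F) := {Z | tr Z = 0 ∧
    ∃ σ : F →+* F, tr (Y * Z) = σ (tr (X * Z)) ∨ tr (Y * Z) = -σ (tr (X * Z))}
  have h₁ : S₁.ncard ≤ d * (f * Nat.card F) := by
    refine (ncard_le_of_tr hd hX hY hXY S₁
      (Set.range fun s : (F →+* F) × F => (s.1 (tr (X * Y)), s.2)) ?_).trans
      (Nat.mul_le_mul_left _ (hrange _))
    rintro Z ⟨hZ, σ, h⟩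
    exact ⟨hZ, (σ, tr (Y * Z)), by rw [h]⟩
  have h₂ : S₂.ncard ≤ d * (f * Nat.card F) := by
    refine (ncard_le_of_tr hd hX hY hXY S₂
      (Set.range fun s : (F →+* F) × F => (s.2, s.1 (tr (X * Y)))) ?_).trans
      (Nat.mul_le_mul_left _ (hrange _))
    rintro Z ⟨hZ, σ, h⟩
    exact ⟨hZ, (σ, tr (X * Z)), by rw [h]⟩
  have h₃ : S₃.ncard ≤ d * (d * (f * Nat.card F)) := by
    let g₁ : (F →+* F) × F → F × F := fun s => (s.2, s.1 s.2)
    let g₂ : (F →+* F) × F → F × F := fun s => (s.2, -s.1 s.2)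
    refine (ncard_le_of_tr hd hX hY hXY S₃ (Set.range g₁ ∪ Set.range g₂) ?_).trans
      (Nat.mul_le_mul_left _ ?_)
    · rintro Z ⟨hZ, σ, h | h⟩
      · exact ⟨hZ, Or.inl ⟨(σ, tr (X * Z)), by simp only [g₁, h]⟩⟩
      · exact ⟨hZ, Or.inr ⟨(σ, tr (X * Z)), by simp only [g₂, h]⟩⟩
    · rcases hd with ⟨rfl, h2F⟩ | rfl
      · have : g₂ = g₁ := by
          funext s
          have : -s.1 s.2 = s.1 s.2 := by linear_combination -s.1 s.2 * h2F
          simp only [g₁, g₂, this]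
        rw [this, Set.union_self, one_mul]
        exact hrange _
      · rw [two_mul]
        exact (Set.ncard_union_le _ _).trans (add_le_add (hrange _) (hrange _))
  set good := {z : PSL(2, F) | orderOf z = 2 ∧ Subgroup.closure {proj X, proj Y, z} = ⊤ ∧
        autFixing PSL(2, F) {proj X, proj Y, z} = ⊥} with hgood
  have hsub : {z : PSL(2, F) | orderOf z = 2} ⊆
      (good ∪ (H : Set PSL(2, F))) ∪ ((proj '' S₁ ∪ proj '' S₂) ∪ proj '' S₃) := by
    intro z hz
    by_contra hnot
    simp only [Set.mem_union, not_or] at hnot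
    obtain ⟨⟨hg, hzH⟩, ⟨hz1, hz2⟩, hz3⟩ := hnot
    have hzH : z ∉ H := hzH
    have hxH : proj X ∈ H := by rw [← hgen]; exact Subgroup.subset_closure (by simp)
    have hyH : proj Y ∈ H := by rw [← hgen]; exact Subgroup.subset_closure (by simp)
    have htop : Subgroup.closure {proj X, proj Y, z} = ⊤ := by
      apply hH.2
      refine lt_of_le_of_ne ?_ ?_
      · rw [← hgen]
        apply Subgroup.closure_mono
        rintro _ (rfl | rfl) <;> simp
      · rintro rfl
        exact hzH (Subgroup.subset_closure (by simp))
    have haut : autFixing PSL(2, F) {proj X, proj Y, z} ≠ ⊥ := fun h => hg ⟨hz, htop, h⟩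
    obtain ⟨Z, rfl⟩ := proj_surjective z
    have hZ : tr Z = 0 := tr_eq_zero_of_orderOf hz
    have hxy : proj X ≠ proj Y := by
      intro h
      apply hXY
      have hXd := det_of_tr_eq_zero hX
      have hXX : tr (X * X) = -2 := by
        rw [tr_mul_of_tr_eq_zero hX hX]; linear_combination 2 * hXd
      rcases proj_eq_iff.1 h with rfl | rfl
      · rw [hXX]; norm_num
      · rw [mul_neg, tr_neg, hXX]; norm_num
    have hneg : tr (-Z) = 0 := by rw [tr_neg, hZ, neg_zero]
    obtain ⟨σ, h | h | h⟩ := exists_tr_relation hxy (fun h => hzH (h ▸ hxH))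
      (fun h => hzH (h ▸ hyH)) htop haut <;> rcases sq_eq_sq_iff_eq_or_eq_neg.1 h with h | h
    · exact hz1 ⟨Z, ⟨hZ, σ, h⟩, rfl⟩
    · exact hz1 ⟨-Z, ⟨hneg, σ, by rw [mul_neg, tr_neg, h, neg_neg]⟩, proj_neg Z⟩
    · exact hz2 ⟨Z, ⟨hZ, σ, h⟩, rfl⟩
    · exact hz2 ⟨-Z, ⟨hneg, σ, by rw [mul_neg, tr_neg, h, neg_neg]⟩, proj_neg Z⟩
    · exact hz3 ⟨Z, ⟨hZ, σ, Or.inl h⟩, rfl⟩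
    · exact hz3 ⟨Z, ⟨hZ, σ, Or.inr h⟩, rfl⟩
  refine (Set.ncard_le_ncard hsub).trans ((Set.ncard_union_le _ _).trans (add_le_add
    ((Set.ncard_union_le _ _).trans_eq rfl) ((Set.ncard_union_le _ _).trans (add_le_add
      ((Set.ncard_union_le _ _).trans ?_) ((Set.ncard_image_le (Set.toFinite _)).trans h₃)))))
  rw [two_mul]
  exact add_le_add ((Set.ncard_image_le (Set.toFinite _)).trans h₁) ((Set.ncard_image_le (Set.toFinite _)).trans h₂)

end PSL2

/-! ### The final estimate -/

theorem proposition3p1 (p f q d : ℕ) (hp : p.Prime) (hqpf : q = p ^ f) (hq : 11 ≤ q)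
    (hd : d = Nat.gcd 2 (q - 1))
    (F : Type*) [Field F] (hF : Nat.card F = q)
    (H : Subgroup (Matrix.ProjectiveSpecialLinearGroup (Fin 2) F))
    (hHdihedral : Nonempty (H ≃* DihedralGroup ((q + 1) / d)))
    (hHmaximal : IsCoatom H)
    (x y : Matrix.ProjectiveSpecialLinearGroup (Fin 2) F)
    (hx : orderOf x = 2) (hy : orderOf y = 2)
    (hxy : Subgroup.closure {x, y} = H) :
    ((q : ℝ) ^ 2 - 4 * (d : ℝ) ^ 2 * f * q - (d + 2) * q - 4 * (d : ℝ) ^ 2 * f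
        - 3 * (d : ℝ) ^ 2 + 2 * d - 1) / d
      ≤ (Set.ncard {z : Matrix.ProjectiveSpecialLinearGroup (Fin 2) F |
          orderOf z = 2 ∧ Subgroup.closure {x, y, z} = ⊤ ∧
          autFixing (Matrix.ProjectiveSpecialLinearGroup (Fin 2) F) {x, y, z} = ⊥} : ℝ) := by
  subst hqpf
  have hf0 : f ≠ 0 := by rintro rfl; norm_num at hq
  obtain ⟨hσ, hσf, hchar⟩ := PSL2.natCard_ringHom_le hp hF
  have hfin : Finite F := Nat.finite_of_card_ne_zero (by omega)
  have hcases : (d = 1 ∧ (2 : F) = 0 ∧ p = 2) ∨ (d = 2 ∧ 2 * ((p ^ f + 1) / d) = p ^ f + 1) := by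
    rcases hp.eq_two_or_odd' with rfl | hodd
    · left
      refine ⟨?_, by exact_mod_cast CharP.cast_eq_zero F 2, rfl⟩
      obtain ⟨k, hk⟩ : 2 ∣ 2 ^ f := dvd_pow_self 2 hf0
      rw [hd]
      have hodd : Odd (2 ^ f - 1) := ⟨k - 1, by omega⟩
      exact Nat.coprime_two_left.2 hodd
    · right
      have h2 : Odd (p ^ f) := hodd.pow
      obtain ⟨k, hk⟩ := h2
      have hd2 : d = 2 := by
        rw [hd, Nat.gcd_eq_left_iff_dvd]
        exact ⟨k, by omega⟩
      refine ⟨hd2, by rw [hd2]; omega⟩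
  have hd' : d = 1 ∧ (2 : F) = 0 ∨ d = 2 := hcases.imp (fun h => ⟨h.1, h.2.1⟩) And.left
  obtain ⟨X, rfl⟩ := PSL2.proj_surjective x
  obtain ⟨Y, rfl⟩ := PSL2.proj_surjective y
  subst hxy
  obtain ⟨e⟩ := hHdihedral
  have hn : 3 ≤ (p ^ f + 1) / d := by
    rcases hd' with ⟨h, -⟩ | h <;> rw [h] <;> omega
  have hXY := PSL2.tr_mul_sq_ne_four (f := f) hp hf0
    (hcases.imp (fun h => h.2.2) And.right) hn hx hy e
  have hupper := PSL2.ncard_involutions_le hσ hσf hd' (PSL2.tr_eq_zero_of_orderOf hx)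
    (PSL2.tr_eq_zero_of_orderOf hy) hXY hHmaximal rfl
  have hlower := PSL2.le_ncard_involutions hd'
  rw [Nat.card_congr e.toEquiv, DihedralGroup.nat_card, hF] at hupper
  rw [hF] at hlower
  generalize Set.ncard {z : Matrix.ProjectiveSpecialLinearGroup (Fin 2) F |
    orderOf z = 2 ∧ Subgroup.closure {PSL2.proj X, PSL2.proj Y, z} = ⊤ ∧
      autFixing (Matrix.ProjectiveSpecialLinearGroup (Fin 2) F)
        {PSL2.proj X, PSL2.proj Y, z} = ⊥} = N at *
  generalize Set.ncard {z : Matrix.ProjectiveSpecialLinearGroup (Fin 2) F | orderOf z = 2} = I at *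
  generalize p ^ f = q at *
  have hq1 : ((q - 1 : ℕ) : ℝ) = q - 1 := by rw [Nat.cast_sub (by omega)]; simp
  have hqR : (11 : ℝ) ≤ q := by exact_mod_cast hq
  have hfR : (0 : ℝ) ≤ f := Nat.cast_nonneg f
  -- After multiplying by `d`, the count exceeds the stated numerator by `f * q + 4 * f` when `d =
  -- 1` and by `q + 16 * f + 7` when `d = 2`.
  rcases hcases with ⟨rfl, -, -⟩ | ⟨rfl, hn2⟩
  · have h := hlower.trans (Nat.mul_le_mul_left 1 hupper)
    rw [Nat.div_one] at h
    have h' : ((q * (q - 1) : ℕ) : ℝ) ≤ _ := Nat.cast_le.2 h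
    push_cast [hq1] at h' ⊢
    nlinarith [mul_nonneg hfR (Nat.cast_nonneg q : (0 : ℝ) ≤ q)]
  · rw [hn2] at hupper
    have h := hlower.trans (Nat.mul_le_mul_left 2 hupper)
    have h' : ((q * (q - 1) : ℕ) : ℝ) ≤ _ := Nat.cast_le.2 h
    push_cast [hq1] at h' ⊢
    rw [div_le_iff₀ (by norm_num)]
    nlinarith [mul_nonneg hfR (Nat.cast_nonneg q : (0 : ℝ) ≤ q)]
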